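/- Let $\omega$ be a primitive cube root of unity and let Alice, Bob and Charlie each hold one factor of $\mathbb{C}^5\otimes\mathbb{C}^5\otimes\mathbb{C}^5$, with computational basis $|0\rangle,\dots,|4\rangle$ in each factor. Consider the (unnormalized) states $$|\phi_1\rangle = |000\rangle+|111\rangle+|222\rangle+|333\rangle+|444\rangle,$$ $$|\phi_2\rangle = |000\rangle-|111\rangle-|222\rangle-\omega|333\rangle-\omega^2|444\rangle,$$ $$|\phi_3\rangle = |011\rangle+|233\rangle .$$ A family of mutually orthogonal states is called locally distinguishable if some LOCC protocol (finitely many rounds; in each round one of the three separated parties performs a measurement with finitely many outcomes on its own system and broadcasts the outcome, and later rounds may depend on it) identifies each state of the family with certainty; otherwise it is called locally indistinguishable. It has local redundancy if the states stay mutually orthogonal after discarding (tracing out) one or more subsystems, a subsystem being the whole system of a party or a tensor factor of it. Then: (1) $|\phi_1\rangle,|\phi_2\rangle,|\phi_3\rangle$ are nonzero and mutually orthogonal, they are locally distinguishable, and they have no local redundancy. (2) There is a measurement by a single party on its own system, with finitely many outcomes $\mu$ and measurement operators $M_\mu$ on $\mathbb{C}^5$, $\sum_\mu M_\mu^\dagger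 M_\mu=I$, not all $M_\mu^\dagger M_\mu$ proportional to the identity, such that for every outcome $\mu$ the three (unnormalized) post-measurement states obtained from $|\phi_1\rangle,|\phi_2\rangle,|\phi_3\rangle$ are nonzero and mutually orthogonal (so there are still three of them) and are locally indistinguishable. -/

import Mathlib

open scoped Kronecker Matrix

/-- Vectors of `ℂ^a ⊗ ℂ^b ⊗ ℂ^c` (not necessarily normalized) in the computational product
basis: the parties Alice, Bob and Charlie hold the three tensor factors. -/
abbrev TriState (a b c : ℕ) : Type := Fin a × Fin b × Fin c → ℂ

/-- The product basis vector `|ijk⟩`. -/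
noncomputable def ket {a b c : ℕ} (i : Fin a) (j : Fin b) (k : Fin c) : TriState a b c :=
  Pi.single (i, j, k) 1

/-- The operator `K ⊗ I ⊗ I` acting on a state. -/
noncomputable def onAlice {a a' b c : ℕ} (K : Matrix (Fin a') (Fin a) ℂ) (ψ : TriState a b c) :
    TriState a' b c :=
  (K ⊗ₖ ((1 : Matrix (Fin b) (Fin b) ℂ) ⊗ₖ (1 : Matrix (Fin c) (Fin c) ℂ))) *ᵥ ψ

/-- The operator `I ⊗ K ⊗ I` acting on a state. -/
noncomputable def onBob {a b b' c : ℕ} (K : Matrix (Fin b') (Fin b) ℂ) (ψ : TriState a b c) :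
    TriState a b' c :=
  ((1 : Matrix (Fin a) (Fin a) ℂ) ⊗ₖ (K ⊗ₖ (1 : Matrix (Fin c) (Fin c) ℂ))) *ᵥ ψ

/-- The operator `I ⊗ I ⊗ K` acting on a state. -/
noncomputable def onCharlie {a b c c' : ℕ} (K : Matrix (Fin c') (Fin c) ℂ) (ψ : TriState a b c) :
    TriState a b c' :=
  ((1 : Matrix (Fin a) (Fin a) ℂ) ⊗ₖ ((1 : Matrix (Fin b) (Fin b) ℂ) ⊗ₖ K)) *ᵥ ψ

/-- The measurement operators (Kraus operators) `K x` of a measurement with finitely many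
outcomes `x` satisfy the completeness relation. The dimension of the output space may differ
from that of the input space and may depend on the outcome. -/
def IsMeasurement {n d : ℕ} {d' : Fin n → ℕ} (K : ∀ x, Matrix (Fin (d' x)) (Fin d) ℂ) : Prop :=
  ∑ x, (K x)ᴴ * K x = 1

/-- Tripartite LOCC protocols on `ℂ^a ⊗ ℂ^b ⊗ ℂ^c` that end by announcing a label in `ι`.
In each round one party performs a measurement on the subsystem it holds and broadcasts the
outcome `x`; the rest of the protocol (who acts next, and how) may depend on `x`. Every
protocol has finitely many rounds, their number being arbitrary. -/
inductive LOCCProtocol (ι : Type) : ℕ → ℕ → ℕ → Type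
  | announce {a b c : ℕ} (j : ι) : LOCCProtocol ι a b c
  | alice {a b c : ℕ} (n : ℕ) (d' : Fin n → ℕ) (K : ∀ x, Matrix (Fin (d' x)) (Fin a) ℂ)
      (hK : IsMeasurement K) (next : ∀ x, LOCCProtocol ι (d' x) b c) : LOCCProtocol ι a b c
  | bob {a b c : ℕ} (n : ℕ) (d' : Fin n → ℕ) (K : ∀ x, Matrix (Fin (d' x)) (Fin b) ℂ)
      (hK : IsMeasurement K) (next : ∀ x, LOCCProtocol ι a (d' x) c) : LOCCProtocol ι a b c
  | charlie {a b c : ℕ} (n : ℕ) (d' : Fin n → ℕ) (K : ∀ x, Matrix (Fin (d' x)) (Fin c) ℂ)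
      (hK : IsMeasurement K) (next : ∀ x, LOCCProtocol ι a b (d' x)) : LOCCProtocol ι a b c

/-- Run on the state `ψ`, the protocol announces the label `i` with certainty: a sequence of
outcomes has nonzero probability iff the resulting unnormalized state is nonzero, and every such
sequence leads to the announcement `i`. -/
def LOCCProtocol.Identifies {ι : Type} :
    {a b c : ℕ} → LOCCProtocol ι a b c → TriState a b c → ι → Prop
  | _, _, _, .announce j, ψ, i => ψ ≠ 0 → j = i
  | _, _, _, .alice _ _ K _ next, ψ, i => ∀ x, (next x).Identifies (onAlice (K x) ψ) i
  | _, _, _, .bob _ _ K _ next, ψ, i => ∀ x, (next x).Identifies (onBob (K x) ψ) i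
  | _, _, _, .charlie _ _ K _ next, ψ, i => ∀ x, (next x).Identifies (onCharlie (K x) ψ) i

/-- The states `ψ i` can be perfectly distinguished by LOCC: a single protocol identifies each
of them with certainty. -/
def LocallyDistinguishable {ι : Type} {a b c : ℕ} (ψ : ι → TriState a b c) : Prop :=
  ∃ P : LOCCProtocol ι a b c, ∀ i, P.Identifies (ψ i) i

/-- The `ψ i` are (unnormalized) states, hence nonzero, and they are mutually orthogonal. In
particular, they are pairwise different. -/
def IsOrthogonalSet {ι : Type} {a b c : ℕ} (ψ : ι → TriState a b c) : Prop :=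
  (∀ i, ψ i ≠ 0) ∧ Pairwise fun i j => star (ψ i) ⬝ᵥ ψ j = 0

/-- `U` is a unitary identification of `ℂ^d` with `ℂ^m ⊗ ℂ^n`. -/
def IsFactorization {d m n : ℕ} (U : Matrix (Fin m × Fin n) (Fin d) ℂ) : Prop :=
  Uᴴ * U = 1 ∧ U * Uᴴ = 1

/-- The (unnormalized) reduced density matrix of `|ψ⟩⟨ψ|` after each party has split its system
into two subsystems through `U`, `V`, `W`, and the second subsystem of each party has been
traced out. -/
noncomputable def reducedState {a a₁ a₂ b b₁ b₂ c c₁ c₂ : ℕ}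
    (U : Matrix (Fin a₁ × Fin a₂) (Fin a) ℂ) (V : Matrix (Fin b₁ × Fin b₂) (Fin b) ℂ)
    (W : Matrix (Fin c₁ × Fin c₂) (Fin c) ℂ) (ψ : TriState a b c) :
    Matrix (Fin a₁ × Fin b₁ × Fin c₁) (Fin a₁ × Fin b₁ × Fin c₁) ℂ :=
  Matrix.of fun x y => ∑ z : Fin a₂ × Fin b₂ × Fin c₂,
    ((U ⊗ₖ (V ⊗ₖ W)) *ᵥ ψ) ((x.1, z.1), (x.2.1, z.2.1), (x.2.2, z.2.2)) *
      star (((U ⊗ₖ (V ⊗ₖ W)) *ᵥ ψ) ((y.1, z.1), (y.2.1, z.2.1), (y.2.2, z.2.2)))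

/-- The states remain mutually orthogonal after one or more subsystems are discarded. The
discarded subsystem of a party may be a tensor factor of its system or the whole system (when
the first factor has dimension one); a party discards nothing when the second factor has
dimension one. -/
def HasLocalRedundancy {ι : Type} {a b c : ℕ} (ψ : ι → TriState a b c) : Prop :=
  ∃ (a₁ a₂ b₁ b₂ c₁ c₂ : ℕ) (U : Matrix (Fin a₁ × Fin a₂) (Fin a) ℂ)
    (V : Matrix (Fin b₁ × Fin b₂) (Fin b) ℂ) (W : Matrix (Fin c₁ × Fin c₂) (Fin c) ℂ),
    IsFactorization U ∧ IsFactorization V ∧ IsFactorization W ∧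
    (1 < a₂ ∨ 1 < b₂ ∨ 1 < c₂) ∧
    Pairwise fun i j => reducedState U V W (ψ i) * reducedState U V W (ψ j) = 0

/-- The operator `K` of the party `p` (`0` Alice, `1` Bob, `2` Charlie) acting on a state. -/
noncomputable def onParty {d : ℕ} (p : Fin 3) (K : Matrix (Fin d) (Fin d) ℂ)
    (ψ : TriState d d d) : TriState d d d :=
  match p with
  | 0 => onAlice K ψ
  | 1 => onBob K ψ
  | 2 => onCharlie K ψ

/-- The three states
`φ₁ = |000⟩ + |111⟩ + |222⟩ + |333⟩ + |444⟩`,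
`φ₂ = |000⟩ - |111⟩ - |222⟩ - ω|333⟩ - ω²|444⟩`,
`φ₃ = |011⟩ + |233⟩`. -/
noncomputable def phi (ω : ℂ) : Fin 3 → TriState 5 5 5 :=
  ![ket 0 0 0 + ket 1 1 1 + ket 2 2 2 + ket 3 3 3 + ket 4 4 4,
    ket 0 0 0 - ket 1 1 1 - ket 2 2 2 - ω • ket 3 3 3 - ω ^ 2 • ket 4 4 4,
    ket 0 1 1 + ket 2 3 3]

/-! Distinguishing. Each party measures in the basis |0⟩ ± |2⟩ together with the Fourier basis of
span{|1⟩, |3⟩, |4⟩}. On {0, 2} the first two states are |000⟩ ± |222⟩, told apart by a parity; on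
{1, 3, 4} they carry the phases (1, 1, 1) and -(1, ω, ω²), told apart by a sum mod 3. Only the third
state puts Alice and Bob in different blocks.

Redundancy. Since 5 is prime, a discarded subsystem is a whole party. Tracing it out erases the
phases of ∑ fᵢ|iii⟩, so the first two states get the same nonzero reduced state
(`reducedState_diagState_eq`).

Activation. Alice projects onto {0, 1} or {2, 3, 4}. A protocol preserves total squared norm, and
each of its branches applies a product operator that leaves at most one state alive. A real
combination of squared norms that is nonnegative on all such branches but negative initially
therefore excludes every protocol (`LOCCProtocol.sum_sqNorm_nonneg`). Product operators enter
through `sqNorm_onAll_ket`: killing |011⟩ kills |000⟩ or |111⟩, and killing |233⟩ kills |222⟩ or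
|333⟩. -/

/-! ### Squared norms and measurements -/

/-- The squared norm of a (not necessarily normalized) vector. -/
noncomputable def sqNorm {κ : Type*} [Fintype κ] (ψ : κ → ℂ) : ℝ := ∑ s, ‖ψ s‖ ^ 2

section SqNorm

variable {κ : Type*} [Fintype κ]

theorem sqNorm_zero : sqNorm (0 : κ → ℂ) = 0 := by simp [sqNorm]

theorem sqNorm_nonneg (ψ : κ → ℂ) : 0 ≤ sqNorm ψ :=
  Finset.sum_nonneg fun _ _ => by positivity

theorem sqNorm_smul (c : ℂ) (ψ : κ → ℂ) : sqNorm (c • ψ) = ‖c‖ ^ 2 * sqNorm ψ := by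
  simp [sqNorm, Finset.mul_sum, mul_pow]

theorem sqNorm_neg (ψ : κ → ℂ) : sqNorm (-ψ) = sqNorm ψ := by simp [sqNorm]

theorem sqNorm_add_le (ψ χ : κ → ℂ) : sqNorm (ψ + χ) ≤ 2 * sqNorm ψ + 2 * sqNorm χ := by
  simp only [sqNorm, Finset.mul_sum, ← Finset.sum_add_distrib]
  refine Finset.sum_le_sum fun s _ => ?_
  have h := norm_add_le (ψ s) (χ s)
  have h0 := norm_nonneg (ψ s + χ s)
  simp only [Pi.add_apply]
  nlinarith [sq_nonneg (‖ψ s‖ - ‖χ s‖)]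

theorem ofReal_sqNorm (ψ : κ → ℂ) : ((sqNorm ψ : ℝ) : ℂ) = star ψ ⬝ᵥ ψ := by
  simp [sqNorm, dotProduct, ← Complex.conj_mul']

theorem sum_sqNorm_mulVec {n : ℕ} {κ' : Fin n → Type*} [∀ x, Fintype (κ' x)] [DecidableEq κ]
    (L : ∀ x, Matrix (κ' x) κ ℂ) (hL : ∑ x, (L x)ᴴ * L x = 1) (ψ : κ → ℂ) :
    ∑ x, sqNorm (L x *ᵥ ψ) = sqNorm ψ := by
  have h : ((∑ x, sqNorm (L x *ᵥ ψ) : ℝ) : ℂ) = (sqNorm ψ : ℝ) := by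
    have hψ : ψ = ∑ x, ((L x)ᴴ * L x) *ᵥ ψ := by
      rw [← Matrix.sum_mulVec, hL, Matrix.one_mulVec]
    rw [Complex.ofReal_sum, ofReal_sqNorm]
    conv_rhs => arg 2; rw [hψ]
    rw [dotProduct_sum]
    refine Finset.sum_congr rfl fun x _ => ?_
    rw [ofReal_sqNorm, Matrix.star_mulVec, ← Matrix.dotProduct_mulVec, Matrix.mulVec_mulVec]
  exact_mod_cast h

end SqNorm

section Parties

variable {a b c : ℕ}

theorem sum_sqNorm_onAlice {n : ℕ} {d' : Fin n → ℕ} {K : ∀ x, Matrix (Fin (d' x)) (Fin a) ℂ}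
    (hK : IsMeasurement K) (ψ : TriState a b c) : ∑ x, sqNorm (onAlice (K x) ψ) = sqNorm ψ := by
  refine sum_sqNorm_mulVec
    (fun x => K x ⊗ₖ ((1 : Matrix (Fin b) (Fin b) ℂ) ⊗ₖ (1 : Matrix (Fin c) (Fin c) ℂ))) ?_ ψ
  simp only [Matrix.conjTranspose_kronecker, ← Matrix.mul_kronecker_mul, Matrix.conjTranspose_one,
    mul_one, Matrix.one_kronecker_one]
  have h := congrArg (fun E => E ⊗ₖ (1 : Matrix (Fin b × Fin c) (Fin b × Fin c) ℂ)) hK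
  simp only [Matrix.one_kronecker_one] at h
  rw [← h]
  ext s t
  simp [Matrix.sum_apply, Finset.sum_mul]

theorem sum_sqNorm_onBob {n : ℕ} {d' : Fin n → ℕ} {K : ∀ x, Matrix (Fin (d' x)) (Fin b) ℂ}
    (hK : IsMeasurement K) (ψ : TriState a b c) : ∑ x, sqNorm (onBob (K x) ψ) = sqNorm ψ := by
  refine sum_sqNorm_mulVec
    (fun x => (1 : Matrix (Fin a) (Fin a) ℂ) ⊗ₖ (K x ⊗ₖ (1 : Matrix (Fin c) (Fin c) ℂ))) ?_ ψ
  simp only [Matrix.conjTranspose_kronecker, ← Matrix.mul_kronecker_mul, Matrix.conjTranspose_one,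
    mul_one]
  have h := congrArg (fun E => (1 : Matrix (Fin a) (Fin a) ℂ) ⊗ₖ
    (E ⊗ₖ (1 : Matrix (Fin c) (Fin c) ℂ))) hK
  simp only [Matrix.one_kronecker_one] at h
  rw [← h]
  ext s t
  simp [Matrix.sum_apply, Finset.sum_mul, Finset.mul_sum]

theorem sum_sqNorm_onCharlie {n : ℕ} {d' : Fin n → ℕ} {K : ∀ x, Matrix (Fin (d' x)) (Fin c) ℂ}
    (hK : IsMeasurement K) (ψ : TriState a b c) :
    ∑ x, sqNorm (onCharlie (K x) ψ) = sqNorm ψ := by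
  refine sum_sqNorm_mulVec
    (fun x => (1 : Matrix (Fin a) (Fin a) ℂ) ⊗ₖ ((1 : Matrix (Fin b) (Fin b) ℂ) ⊗ₖ K x)) ?_ ψ
  simp only [Matrix.conjTranspose_kronecker, ← Matrix.mul_kronecker_mul, Matrix.conjTranspose_one,
    mul_one]
  have h := congrArg (fun E => (1 : Matrix (Fin a) (Fin a) ℂ) ⊗ₖ
    ((1 : Matrix (Fin b) (Fin b) ℂ) ⊗ₖ E)) hK
  simp only [Matrix.one_kronecker_one] at h
  rw [← h]
  ext s t
  simp [Matrix.sum_apply, Finset.mul_sum]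

theorem onAlice_apply {a' : ℕ} (K : Matrix (Fin a') (Fin a) ℂ) (ψ : TriState a b c)
    (p : Fin a') (q : Fin b) (r : Fin c) :
    onAlice K ψ (p, q, r) = ∑ i, K p i * ψ (i, q, r) := by
  simp [onAlice, Matrix.mulVec, dotProduct, Fintype.sum_prod_type, Matrix.one_apply]

/-- The product operator `A ⊗ B ⊗ C` acting on a state. -/
noncomputable def onAll {a' b' c' : ℕ} (A : Matrix (Fin a') (Fin a) ℂ)
    (B : Matrix (Fin b') (Fin b) ℂ) (C : Matrix (Fin c') (Fin c) ℂ) (ψ : TriState a b c) :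
    TriState a' b' c' :=
  (A ⊗ₖ (B ⊗ₖ C)) *ᵥ ψ

variable {a' b' c' : ℕ} (A : Matrix (Fin a') (Fin a) ℂ) (B : Matrix (Fin b') (Fin b) ℂ)
  (C : Matrix (Fin c') (Fin c) ℂ)

theorem onAll_one (ψ : TriState a b c) : onAll 1 1 1 ψ = ψ := by simp [onAll]

theorem onAll_add (ψ χ : TriState a b c) :
    onAll A B C (ψ + χ) = onAll A B C ψ + onAll A B C χ := Matrix.mulVec_add _ _ _

theorem onAll_sub (ψ χ : TriState a b c) :
    onAll A B C (ψ - χ) = onAll A B C ψ - onAll A B C χ := Matrix.mulVec_sub _ _ _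

theorem onAll_neg (ψ : TriState a b c) : onAll A B C (-ψ) = -onAll A B C ψ :=
  Matrix.mulVec_neg _ _

theorem onAll_smul (z : ℂ) (ψ : TriState a b c) :
    onAll A B C (z • ψ) = z • onAll A B C ψ := Matrix.mulVec_smul _ _ _

theorem onAll_ket (i : Fin a) (j : Fin b) (k : Fin c) (p : Fin a') (q : Fin b') (r : Fin c') :
    onAll A B C (ket i j k) (p, q, r) = A p i * (B q j * C r k) := by
  simp [onAll, ket]

/-- This factorization is the only place where locality of the operators is used: a vanishing image
forces one party's column to vanish, and that column is shared with other kets. -/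
theorem sqNorm_onAll_ket (i : Fin a) (j : Fin b) (k : Fin c) :
    sqNorm (onAll A B C (ket i j k)) =
      sqNorm (fun p => A p i) * (sqNorm (fun q => B q j) * sqNorm (fun r => C r k)) := by
  simp only [sqNorm, Fintype.sum_prod_type, onAll_ket, norm_mul, mul_pow, ← Finset.mul_sum,
    ← Finset.sum_mul]

end Parties

theorem onAll_onAlice {a a₁ a₂ b b' c c' : ℕ} (A : Matrix (Fin a₂) (Fin a₁) ℂ)
    (B : Matrix (Fin b') (Fin b) ℂ) (C : Matrix (Fin c') (Fin c) ℂ)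
    (K : Matrix (Fin a₁) (Fin a) ℂ) (ψ : TriState a b c) :
    onAll A B C (onAlice K ψ) = onAll (A * K) B C ψ := by
  simp [onAll, onAlice, ← Matrix.mul_kronecker_mul]

theorem onAll_onBob {a a' b b₁ b₂ c c' : ℕ} (A : Matrix (Fin a') (Fin a) ℂ)
    (B : Matrix (Fin b₂) (Fin b₁) ℂ) (C : Matrix (Fin c') (Fin c) ℂ)
    (K : Matrix (Fin b₁) (Fin b) ℂ) (ψ : TriState a b c) :
    onAll A B C (onBob K ψ) = onAll A (B * K) C ψ := by
  simp [onAll, onBob, ← Matrix.mul_kronecker_mul]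

theorem onAll_onCharlie {a a' b b' c c₁ c₂ : ℕ} (A : Matrix (Fin a') (Fin a) ℂ)
    (B : Matrix (Fin b') (Fin b) ℂ) (C : Matrix (Fin c₂) (Fin c₁) ℂ)
    (K : Matrix (Fin c₁) (Fin c) ℂ) (ψ : TriState a b c) :
    onAll A B C (onCharlie K ψ) = onAll A B (C * K) ψ := by
  simp [onAll, onCharlie, ← Matrix.mul_kronecker_mul]

theorem onCharlie_onBob_onAlice {a a' b b' c c' : ℕ} (A : Matrix (Fin a') (Fin a) ℂ)
    (B : Matrix (Fin b') (Fin b) ℂ) (C : Matrix (Fin c') (Fin c) ℂ) (ψ : TriState a b c) :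
    onCharlie C (onBob B (onAlice A ψ)) = onAll A B C ψ := by
  simp [onAll, onAlice, onBob, onCharlie, ← Matrix.mul_kronecker_mul]

/-! ### A criterion for local indistinguishability -/

/-- A real combination of squared norms is conserved on average by a protocol. Hence it is
nonnegative as soon as it is nonnegative after every product operator that leaves at most one of
the states to be identified nonzero. -/
theorem LOCCProtocol.sum_sqNorm_nonneg {ι κ : Type} [Fintype κ] (w : κ → ℝ) {a b c : ℕ}
    (P : LOCCProtocol ι a b c) (ψ : ι → TriState a b c) (χ : κ → TriState a b c)
    (hP : ∀ i, P.Identifies (ψ i) i)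
    (h : ∀ (a' b' c' : ℕ) (A : Matrix (Fin a') (Fin a) ℂ) (B : Matrix (Fin b') (Fin b) ℂ)
      (C : Matrix (Fin c') (Fin c) ℂ) (j : ι), (∀ i, j ≠ i → onAll A B C (ψ i) = 0) →
      0 ≤ ∑ k, w k * sqNorm (onAll A B C (χ k))) :
    0 ≤ ∑ k, w k * sqNorm (χ k) := by
  induction P with
  | announce j =>
    have := h _ _ _ 1 1 1 j fun i hi => by
      rw [onAll_one]
      by_contra h0
      exact hi (hP i h0)
    simpa only [onAll_one] using this
  | alice n d' K hK next ih =>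
    simp only [← sum_sqNorm_onAlice hK, Finset.mul_sum]
    rw [Finset.sum_comm]
    -- A product operator applied after the Kraus operator is again a product operator on the
    -- original states, so `h` passes to every branch.
    refine Finset.sum_nonneg fun x _ => ih x _ (fun k => onAlice (K x) (χ k)) (fun i => hP i x) ?_
    intro a' b' c' A B C j hj
    simp only [onAll_onAlice] at hj ⊢
    exact h _ _ _ _ _ _ j hj
  | bob n d' K hK next ih =>
    simp only [← sum_sqNorm_onBob hK, Finset.mul_sum]
    rw [Finset.sum_comm]
    refine Finset.sum_nonneg fun x _ => ih x _ (fun k => onBob (K x) (χ k)) (fun i => hP i x) ?_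
    intro a' b' c' A B C j hj
    simp only [onAll_onBob] at hj ⊢
    exact h _ _ _ _ _ _ j hj
  | charlie n d' K hK next ih =>
    simp only [← sum_sqNorm_onCharlie hK, Finset.mul_sum]
    rw [Finset.sum_comm]
    refine Finset.sum_nonneg fun x _ =>
      ih x _ (fun k => onCharlie (K x) (χ k)) (fun i => hP i x) ?_
    intro a' b' c' A B C j hj
    simp only [onAll_onCharlie] at hj ⊢
    exact h _ _ _ _ _ _ j hj

theorem sqNorm_ket {a b c : ℕ} (i : Fin a) (j : Fin b) (k : Fin c) :
    sqNorm (ket i j k) = 1 := by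
  simp [sqNorm, ket, Pi.single_apply, apply_ite]

/-- The states `|000⟩ ± |111⟩` and `|011⟩` of `ℂ^5 ⊗ ℂ^5 ⊗ ℂ^5`. -/
noncomputable def lowStates : Fin 3 → TriState 5 5 5 :=
  ![ket 0 0 0 + ket 1 1 1, ket 0 0 0 - ket 1 1 1, ket 0 1 1]

theorem not_locallyDistinguishable_lowStates : ¬ LocallyDistinguishable lowStates := by
  rintro ⟨P, hP⟩
  -- With weight -1, the criterion reduces to showing that |000⟩ dies on every branch, which
  -- contradicts its initial norm 1.
  have key := P.sum_sqNorm_nonneg (fun _ : Fin 1 => -1) lowStates (fun _ => ket 0 0 0) hP ?_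
  · norm_num [sqNorm_ket] at key
  intro a' b' c' A B C j hj
  have e0 := sqNorm_onAll_ket A B C 0 0 0
  have e1 := sqNorm_onAll_ket A B C 1 1 1
  have e2 := sqNorm_onAll_ket A B C 0 1 1
  have h0 : j ≠ 0 → onAll A B C (ket 0 0 0) + onAll A B C (ket 1 1 1) = 0 := fun h => by
    simpa [lowStates, onAll_add] using hj 0 h
  have h1 : j ≠ 1 → onAll A B C (ket 0 0 0) = onAll A B C (ket 1 1 1) := fun h => by
    simpa [lowStates, onAll_sub, sub_eq_zero] using hj 1 h
  have h2 : j ≠ 2 → onAll A B C (ket 0 1 1) = 0 := fun h => by simpa [lowStates] using hj 2 h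
  simp only [Finset.univ_unique, Finset.sum_singleton]
  generalize onAll A B C (ket 0 0 0) = u at *
  generalize onAll A B C (ket 1 1 1) = v at *
  generalize onAll A B C (ket 0 1 1) = t at *
  suffices sqNorm u = 0 by simp [this]
  by_cases hj2 : j = 2
  · subst hj2
    have hv := h1 (by decide)
    have hu := h0 (by decide)
    rw [← hv, ← two_smul ℂ u, smul_eq_zero] at hu
    rw [hu.resolve_left two_ne_zero, sqNorm_zero]
  · rw [h2 hj2, sqNorm_zero] at e2
    have huv : sqNorm u = sqNorm v := by
      by_cases hj0 : j = 0
      · rw [h1 (by simp [hj0])]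
      · rw [eq_neg_of_add_eq_zero_left (h0 hj0), sqNorm_neg]
    rcases mul_eq_zero.1 e2.symm with h | h
    · rw [e0, h, zero_mul]
    · rw [huv, e1, h, mul_zero]

/-- The states `|222⟩ + |333⟩ + |444⟩`, `-(|222⟩ + ω|333⟩ + ω²|444⟩)` and `|233⟩` of
`ℂ^5 ⊗ ℂ^5 ⊗ ℂ^5`. -/
noncomputable def highStates (ω : ℂ) : Fin 3 → TriState 5 5 5 :=
  ![ket 2 2 2 + ket 3 3 3 + ket 4 4 4, -(ket 2 2 2 + ω • ket 3 3 3 + ω ^ 2 • ket 4 4 4),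
    ket 2 3 3]

theorem IsPrimitiveRoot.one_add_add_sq {ω : ℂ} (hω : IsPrimitiveRoot ω 3) :
    1 + ω + ω ^ 2 = 0 := by
  simpa [Finset.sum_range_succ] using hω.geom_sum_eq_zero (by norm_num)

theorem sqNorm_highStates_zero (ω : ℂ) : sqNorm (highStates ω 0) = 3 := by
  have h : ((sqNorm (highStates ω 0) : ℝ) : ℂ) = 3 := by
    rw [ofReal_sqNorm]
    simp [highStates, ket, dotProduct_add]
    norm_num
  exact_mod_cast h

theorem not_locallyDistinguishable_highStates {ω : ℂ} (hω : IsPrimitiveRoot ω 3) :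
    ¬ LocallyDistinguishable (highStates ω) := by
  rintro ⟨P, hP⟩
  -- Let u, v, w be the images of |222⟩, |333⟩, |444⟩. The form 8‖w‖² - 4‖u‖² - 4‖v‖² - ‖u + v + w‖²
  -- starts at 8 - 4 - 4 - 3 = -3. It vanishes if only |233⟩ may survive. Otherwise u or v is zero,
  -- the other has the norm of w, and the form is at least 4‖w‖² - 4‖w‖² = 0.
  have key := P.sum_sqNorm_nonneg ![8, -4, -4, -1] (highStates ω)
    ![ket 4 4 4, ket 2 2 2, ket 3 3 3, highStates ω 0] hP ?_
  · simp only [Fin.sum_univ_four, Matrix.cons_val, sqNorm_ket, sqNorm_highStates_zero] at key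
    norm_num at key
  intro a' b' c' A B C j hj
  have hsum := hω.one_add_add_sq
  have hn : ‖ω‖ = 1 := hω.norm'_eq_one (by norm_num)
  have e2 := sqNorm_onAll_ket A B C 2 2 2
  have e3 := sqNorm_onAll_ket A B C 3 3 3
  have et := sqNorm_onAll_ket A B C 2 3 3
  have hχ : onAll A B C (highStates ω 0) =
      onAll A B C (ket 2 2 2) + onAll A B C (ket 3 3 3) + onAll A B C (ket 4 4 4) := by
    simp [highStates, onAll_add]
  have h0 := hj 0
  have h1 : j ≠ 1 → onAll A B C (ket 2 2 2) + ω • onAll A B C (ket 3 3 3) +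
      ω ^ 2 • onAll A B C (ket 4 4 4) = 0 := fun h => by
    simpa only [highStates, onAll_add, onAll_neg, onAll_smul, neg_eq_zero, Matrix.cons_val_one,
      Matrix.cons_val_zero] using hj 1 h
  have h2 : j ≠ 2 → onAll A B C (ket 2 3 3) = 0 := fun h => by
    simpa [highStates] using hj 2 h
  simp only [Fin.sum_univ_four, Matrix.cons_val]
  rw [hχ] at h0 ⊢
  clear hj hχ
  generalize onAll A B C (ket 2 2 2) = u at *
  generalize onAll A B C (ket 3 3 3) = v at *
  generalize onAll A B C (ket 4 4 4) = w at *
  generalize onAll A B C (ket 2 3 3) = t at *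
  have hw := sqNorm_nonneg w
  by_cases hj2 : j = 2
  · subst hj2
    have h0 := h0 (by decide)
    have h1 := h1 (by decide)
    have hω1 : ω - 1 ≠ 0 := sub_ne_zero.2 (hω.ne_one (by norm_num))
    have hv : v = ω ^ 2 • w := by
      funext s
      have k0 := congrFun h0 s
      have k1 := congrFun h1 s
      simp only [Pi.add_apply, Pi.smul_apply, Pi.zero_apply, smul_eq_mul] at k0 k1 ⊢
      refine mul_left_cancel₀ hω1 ?_
      linear_combination k1 - k0 - w s * (ω - 1) * hsum
    have hu : u = ω • w := by
      funext s
      have k0 := congrFun h0 s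
      rw [hv] at k0
      simp only [Pi.add_apply, Pi.smul_apply, Pi.zero_apply, smul_eq_mul] at k0 ⊢
      linear_combination k0 - w s * hsum
    rw [h0, hv, hu, sqNorm_zero, sqNorm_smul, sqNorm_smul]
    norm_num [hn]
    linarith
  · rw [h2 hj2, sqNorm_zero] at et
    have cases : (u = 0 ∧ sqNorm v = sqNorm w) ∨ (v = 0 ∧ sqNorm u = sqNorm w) := by
      have hzero : ∀ x : TriState a' b' c', sqNorm x = 0 → x = 0 := fun x hx => by
        funext s
        have := (Finset.sum_eq_zero_iff_of_nonneg (fun s _ => by positivity)).1 hx s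
          (Finset.mem_univ s)
        simpa using this
      have hor : u = 0 ∨ v = 0 := by
        rcases mul_eq_zero.1 et.symm with h | h
        · exact Or.inl (hzero u (by rw [e2, h, zero_mul]))
        · exact Or.inr (hzero v (by rw [e3, h, mul_zero]))
      -- At least one of the first two states is killed; in either case the relation has unimodular
      -- coefficients.
      have hrel : ∃ z₁ z₂ : ℂ, ‖z₁‖ = 1 ∧ ‖z₂‖ = 1 ∧ u + z₁ • v + z₂ • w = 0 := by
        by_cases hj1 : j = 1
        · exact ⟨1, 1, by simp, by simp, by simpa using h0 (by simp [hj1])⟩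
        · exact ⟨ω, ω ^ 2, hn, by simp [hn], h1 hj1⟩
      obtain ⟨z₁, z₂, n₁, n₂, hz⟩ := hrel
      have s₁ := sqNorm_smul z₁ v
      have s₂ := sqNorm_smul z₂ w
      rw [n₁, one_pow, one_mul] at s₁
      rw [n₂, one_pow, one_mul] at s₂
      refine hor.imp (fun h => ⟨h, ?_⟩) fun h => ⟨h, ?_⟩
      · rw [h, zero_add] at hz
        rw [← s₁, eq_neg_of_add_eq_zero_left hz, sqNorm_neg, s₂]
      · rw [h, smul_zero, add_zero] at hz
        rw [eq_neg_of_add_eq_zero_left hz, sqNorm_neg, s₂]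
    rcases cases with ⟨rfl, h⟩ | ⟨rfl, h⟩
    · have := sqNorm_add_le v w
      rw [zero_add, sqNorm_zero]
      linarith
    · have := sqNorm_add_le u w
      rw [add_zero, sqNorm_zero]
      linarith

/-! ### Alice's measurement -/

theorem onAlice_diagonal_ket {a b c : ℕ} (m : Fin a → ℂ) (i : Fin a) (j : Fin b) (k : Fin c) :
    onAlice (Matrix.diagonal m) (ket i j k) = m i • ket i j k := by
  funext ⟨p, q, r⟩
  rw [onAlice_apply, Finset.sum_eq_single p (fun t _ ht => by
    rw [Matrix.diagonal_apply_ne _ ht.symm, zero_mul]) (by simp)]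
  by_cases h : p = i <;> simp [ket, Pi.single_apply, h]

theorem onAlice_phi (ω : ℂ) (m : Fin 5 → ℂ) (i : Fin 3) :
    onAlice (Matrix.diagonal m) (phi ω i) =
      ![m 0 • ket 0 0 0 + m 1 • ket 1 1 1 + m 2 • ket 2 2 2 + m 3 • ket 3 3 3 + m 4 • ket 4 4 4,
        m 0 • ket 0 0 0 - m 1 • ket 1 1 1 - m 2 • ket 2 2 2 - ω • m 3 • ket 3 3 3
          - ω ^ 2 • m 4 • ket 4 4 4,
        m 0 • ket 0 1 1 + m 2 • ket 2 3 3] i := by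
  have hadd : ∀ ψ χ : TriState 5 5 5, onAlice (Matrix.diagonal m) (ψ + χ) =
      onAlice (Matrix.diagonal m) ψ + onAlice (Matrix.diagonal m) χ := Matrix.mulVec_add _
  have hsub : ∀ ψ χ : TriState 5 5 5, onAlice (Matrix.diagonal m) (ψ - χ) =
      onAlice (Matrix.diagonal m) ψ - onAlice (Matrix.diagonal m) χ := Matrix.mulVec_sub _
  have hsmul : ∀ (z : ℂ) (ψ : TriState 5 5 5), onAlice (Matrix.diagonal m) (z • ψ) =
      z • onAlice (Matrix.diagonal m) ψ := Matrix.mulVec_smul _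
  fin_cases i <;> simp [phi, hadd, hsub, hsmul, onAlice_diagonal_ket]

/-- The projections onto the spans of `|0⟩, |1⟩` and of `|2⟩, |3⟩, |4⟩`. -/
noncomputable def splitting : Fin 2 → Matrix (Fin 5) (Fin 5) ℂ :=
  ![Matrix.diagonal ![1, 1, 0, 0, 0], Matrix.diagonal ![0, 0, 1, 1, 1]]

theorem isMeasurement_splitting : IsMeasurement splitting := by
  simp only [IsMeasurement, Fin.sum_univ_two, splitting, Matrix.cons_val_zero,
    Matrix.cons_val_one, Matrix.diagonal_conjTranspose, Matrix.diagonal_mul_diagonal,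
    Matrix.diagonal_add, ← Matrix.diagonal_one]
  congr 1
  funext i
  fin_cases i <;> simp

theorem splitting_not_trivial :
    ¬ ∀ μ, ∃ t : ℂ, (splitting μ)ᴴ * splitting μ = t • (1 : Matrix (Fin 5) (Fin 5) ℂ) := by
  intro h
  obtain ⟨t, ht⟩ := h 0
  have h0 := congrFun (congrFun ht 0) 0
  have h2 := congrFun (congrFun ht 2) 2
  simp [splitting, Matrix.diagonal_conjTranspose] at h0 h2
  exact one_ne_zero (h0.trans h2.symm)

theorem splitting_zero_phi (ω : ℂ) :
    (fun i => onParty 0 (splitting 0) (phi ω i)) = lowStates := by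
  funext i
  change onAlice (Matrix.diagonal _) (phi ω i) = _
  rw [onAlice_phi]
  fin_cases i <;> simp [lowStates]

theorem splitting_one_phi (ω : ℂ) :
    (fun i => onParty 0 (splitting 1) (phi ω i)) = highStates ω := by
  funext i
  change onAlice (Matrix.diagonal _) (phi ω i) = _
  rw [onAlice_phi]
  fin_cases i <;> simp [highStates]
  abel

/-! ### Orthogonality -/

theorem isOrthogonalSet_lowStates : IsOrthogonalSet lowStates := by
  constructor
  · intro i h
    have h0 := congrFun h (0, 0, 0)
    have h1 := congrFun h (0, 1, 1)
    fin_cases i <;> simp [lowStates, ket] at h0 h1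
  · intro i j hij
    fin_cases i <;> fin_cases j <;>
      simp [lowStates, ket] at hij ⊢

theorem isOrthogonalSet_highStates {ω : ℂ} (hω : IsPrimitiveRoot ω 3) :
    IsOrthogonalSet (highStates ω) := by
  have hsum := hω.one_add_add_sq
  have hsum' := congrArg star hsum
  simp at hsum'
  constructor
  · intro i h
    have h0 := congrFun h (2, 2, 2)
    have h1 := congrFun h (2, 3, 3)
    fin_cases i <;> simp [highStates, ket] at h0 h1
  · intro i j hij
    fin_cases i <;> fin_cases j <;>
      simp [highStates, ket] at hij ⊢
    · linear_combination -hsum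
    · linear_combination -hsum'

theorem isOrthogonalSet_phi {ω : ℂ} (hω : IsPrimitiveRoot ω 3) : IsOrthogonalSet (phi ω) := by
  have hsum := hω.one_add_add_sq
  have hsum' := congrArg star hsum
  simp at hsum'
  constructor
  · intro i h
    have h0 := congrFun h (0, 0, 0)
    have h1 := congrFun h (0, 1, 1)
    fin_cases i <;> simp [phi, ket] at h0 h1
  · intro i j hij
    fin_cases i <;> fin_cases j <;>
      simp [phi, ket] at hij ⊢
    · linear_combination -hsum
    · linear_combination -hsum'

/-! ### A protocol that distinguishes the states -/

/-- Unnormalized orthogonal basis of `ℂ^5`: `|0⟩ ± |2⟩` and the Fourier basis of the span of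
`|1⟩, |3⟩, |4⟩`. -/
noncomputable def rowVec (ω : ℂ) : Fin 5 → Fin 5 → ℂ :=
  ![![1, 0, 1, 0, 0], ![1, 0, -1, 0, 0], ![0, 1, 0, 1, 1], ![0, 1, 0, ω, ω ^ 2],
    ![0, 1, 0, ω ^ 2, ω]]

/-- The normalizing factors of `rowVec`. -/
noncomputable def rowScale : Fin 5 → ℂ :=
  ![((√2)⁻¹ : ℝ), ((√2)⁻¹ : ℝ), ((√3)⁻¹ : ℝ), ((√3)⁻¹ : ℝ), ((√3)⁻¹ : ℝ)]

/-- The rank one measurement in the basis `rowVec`. -/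
noncomputable def rowKraus (ω : ℂ) (x : Fin 5) : Matrix (Fin 1) (Fin 5) ℂ :=
  Matrix.of fun _ i => rowScale x * rowVec ω x i

theorem isMeasurement_rowKraus {ω : ℂ} (hω : IsPrimitiveRoot ω 3) :
    IsMeasurement (rowKraus ω) := by
  have hsum := hω.one_add_add_sq
  have hn : ‖ω‖ = 1 := hω.norm'_eq_one (by norm_num)
  have h3 := hω.pow_eq_one
  have hstar : (starRingEnd ℂ) ω = ω ^ 2 := by
    have h1 : (starRingEnd ℂ) ω * ω = 1 := by rw [Complex.conj_mul', hn]; simp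
    linear_combination ω ^ 2 * h1 - (starRingEnd ℂ) ω * h3
  have q2 : (((√2)⁻¹ : ℝ) : ℂ) * (((√2)⁻¹ : ℝ) : ℂ) = 1 / 2 := by
    rw [← Complex.ofReal_mul, ← mul_inv, Real.mul_self_sqrt (by norm_num)]; norm_num
  have q3 : (((√3)⁻¹ : ℝ) : ℂ) * (((√3)⁻¹ : ℝ) : ℂ) = 1 / 3 := by
    rw [← Complex.ofReal_mul, ← mul_inv, Real.mul_self_sqrt (by norm_num)]; norm_num
  have entry : ∀ i j, (∑ x, (rowKraus ω x)ᴴ * rowKraus ω x) i j =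
      1 / 2 * (starRingEnd ℂ (rowVec ω 0 i) * rowVec ω 0 j
        + starRingEnd ℂ (rowVec ω 1 i) * rowVec ω 1 j)
      + 1 / 3 * (starRingEnd ℂ (rowVec ω 2 i) * rowVec ω 2 j
        + starRingEnd ℂ (rowVec ω 3 i) * rowVec ω 3 j
        + starRingEnd ℂ (rowVec ω 4 i) * rowVec ω 4 j) := by
    intro i j
    rw [← q2, ← q3]
    simp only [Fin.sum_univ_five, Matrix.add_apply, Matrix.mul_apply, Finset.univ_unique,
      Finset.sum_singleton, rowKraus, Matrix.conjTranspose_apply, Matrix.of_apply, star_mul',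
      RCLike.star_def]
    simp only [rowScale, Matrix.cons_val, Complex.conj_ofReal]
    ring
  unfold IsMeasurement
  ext i j
  rw [entry]
  fin_cases i <;> fin_cases j <;> simp [rowVec, hstar] <;> grind

/-- The announcement after the outcomes `x`, `y`, `z`. -/
def verdict (x y z : Fin 5) : Fin 3 :=
  if x.val < 2 then
    if y.val < 2 then if (x.val + y.val + z.val) % 2 = 0 then 0 else 1 else 2
  else if (x.val + y.val + z.val) % 3 = 0 then 0 else 1

set_option maxHeartbeats 1600000 in
-- When all outcomes lie in one block, the amplitude is 1 + (-1)^(x+y+z) or a geometric sum in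
-- ω^(x+y+z). The Fourier rows start at label 2, but the total shift 6 is harmless mod 3. Mixed
-- blocks give amplitude 0.
theorem verdict_zero {ω : ℂ} (hω : IsPrimitiveRoot ω 3) (x y z : Fin 5) :
    ∑ s, rowVec ω x s * rowVec ω y s * rowVec ω z s = 0 ∨ verdict x y z = 0 := by
  have hsum := hω.one_add_add_sq
  fin_cases x <;> fin_cases y <;> fin_cases z <;>
    simp [verdict, rowVec, Fin.sum_univ_five] <;> grind

set_option maxHeartbeats 1600000 in
theorem verdict_one {ω : ℂ} (hω : IsPrimitiveRoot ω 3) (x y z : Fin 5) :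
    ∑ s, ![1, -1, -1, -ω, -ω ^ 2] s * (rowVec ω x s * rowVec ω y s * rowVec ω z s) = 0 ∨
      verdict x y z = 1 := by
  have hsum := hω.one_add_add_sq
  fin_cases x <;> fin_cases y <;> fin_cases z <;>
    simp [verdict, rowVec, Fin.sum_univ_five] <;> grind

theorem verdict_two (ω : ℂ) (x y z : Fin 5) :
    rowVec ω x 0 * rowVec ω y 1 * rowVec ω z 1 + rowVec ω x 2 * rowVec ω y 3 * rowVec ω z 3 = 0 ∨
      verdict x y z = 2 := by
  fin_cases x <;> fin_cases y <;> simp [verdict, rowVec]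

theorem locallyDistinguishable_phi {ω : ℂ} (hω : IsPrimitiveRoot ω 3) :
    LocallyDistinguishable (phi ω) := by
  have hK := isMeasurement_rowKraus hω
  refine ⟨.alice 5 (fun _ => 1) (rowKraus ω) hK fun x =>
    .bob 5 (fun _ => 1) (rowKraus ω) hK fun y =>
    .charlie 5 (fun _ => 1) (rowKraus ω) hK fun z => .announce (verdict x y z), ?_⟩
  intro i x y z
  change _ ≠ 0 → verdict x y z = i
  refine fun hne => by_contra fun hv => hne ?_
  have e0 := verdict_zero hω x y z
  have e1 := verdict_one hω x y z
  have e2 := verdict_two ω x y z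
  rw [onCharlie_onBob_onAlice]
  funext ⟨p, q, r⟩
  rw [Fin.sum_univ_five] at e0 e1
  fin_cases i
  · have e := e0.resolve_right hv
    simp only [phi, Fin.zero_eta, Matrix.cons_val, onAll_add, Pi.add_apply, onAll_ket, rowKraus,
      Matrix.of_apply, Pi.zero_apply]
    linear_combination rowScale x * rowScale y * rowScale z * e
  · have e := e1.resolve_right hv
    simp only [Matrix.cons_val] at e
    simp only [phi, Fin.mk_one, Matrix.cons_val, onAll_sub, onAll_smul, Pi.sub_apply,
      Pi.smul_apply, smul_eq_mul, onAll_ket, rowKraus, Matrix.of_apply, Pi.zero_apply]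
    linear_combination rowScale x * rowScale y * rowScale z * e
  · have e := e2.resolve_right hv
    simp only [phi, Fin.reduceFinMk, Matrix.cons_val, onAll_add, Pi.add_apply, onAll_ket, rowKraus,
      Matrix.of_apply, Pi.zero_apply]
    linear_combination rowScale x * rowScale y * rowScale z * e

/-! ### Absence of local redundancy -/

theorem IsFactorization.mul_eq {d m n : ℕ} {U : Matrix (Fin m × Fin n) (Fin d) ℂ}
    (hU : IsFactorization U) : m * n = d := by
  have h := congrArg Matrix.trace hU.1
  rw [Matrix.trace_mul_comm, hU.2, Matrix.trace_one, Matrix.trace_one] at h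
  simpa using (by exact_mod_cast h : Fintype.card (Fin m × Fin n) = Fintype.card (Fin d))

theorem IsFactorization.eq_one_of_prime {d m n : ℕ} {U : Matrix (Fin m × Fin n) (Fin d) ℂ}
    (hU : IsFactorization U) (hd : d.Prime) (hn : 1 < n) : m = 1 := by
  have h := hU.mul_eq
  rcases (Nat.prime_mul_iff.1 (h ▸ hd)) with h' | h'
  · omega
  · exact h'.2

theorem IsFactorization.sum_mul_star {d n : ℕ} {U : Matrix (Fin 1 × Fin n) (Fin d) ℂ}
    (hU : IsFactorization U) (x y : Fin 1) (i j : Fin d) :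
    ∑ z, U (x, z) i * star (U (y, z) j) = if i = j then 1 else 0 := by
  obtain rfl := Subsingleton.elim 0 x
  obtain rfl := Subsingleton.elim 0 y
  have h := congrFun (congrFun hU.1 j) i
  simp only [Matrix.mul_apply, Fintype.sum_prod_type, Finset.univ_unique, Finset.sum_singleton,
    Matrix.conjTranspose_apply, Matrix.one_apply, Fin.default_eq_zero, eq_comm (a := j)] at h
  simpa only [mul_comm] using h

/-- Tracing out a system with orthonormal columns forgets the phases `f`. -/
theorem sum_sum_mul_star {α β δ : Type*} [Fintype α] [Fintype β] [Fintype δ] [DecidableEq δ]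
    (f : δ → ℂ) (hf : ∀ i, f i * star (f i) = 1) (u u' : α → δ → ℂ)
    (hu : ∀ i j, ∑ s, u s i * star (u' s j) = if i = j then 1 else 0) (g g' : β → δ → ℂ) :
    ∑ t, ∑ s, (∑ i, f i * (u s i * g t i)) * star (∑ j, f j * (u' s j * g' t j)) =
      ∑ t, ∑ i, g t i * star (g' t i) := by
  refine Finset.sum_congr rfl fun t _ => ?_
  have h1 : ∀ s, (∑ i, f i * (u s i * g t i)) * star (∑ j, f j * (u' s j * g' t j)) =
      ∑ i, ∑ j, f i * star (f j) * (g t i * star (g' t j)) * (u s i * star (u' s j)) := by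
    intro s
    rw [star_sum, Finset.sum_mul_sum]
    refine Finset.sum_congr rfl fun i _ => Finset.sum_congr rfl fun j _ => ?_
    simp only [star_mul']
    ring
  simp only [h1]
  -- Orthonormality in `s` leaves only the terms i = j, where the phases cancel.
  rw [Finset.sum_comm]
  refine Finset.sum_congr rfl fun i _ => ?_
  rw [Finset.sum_comm]
  simp only [← Finset.mul_sum, hu, mul_ite, mul_one, mul_zero, Finset.sum_ite_eq,
    Finset.mem_univ, if_true, hf, one_mul]

/-- The state `∑ i, f i |iii⟩`. -/
noncomputable def diagState {d : ℕ} (f : Fin d → ℂ) : TriState d d d :=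
  ∑ i, f i • ket i i i

theorem kronecker_mulVec_diagState {d : ℕ} {α β γ : Type*} (U : Matrix α (Fin d) ℂ)
    (V : Matrix β (Fin d) ℂ) (W : Matrix γ (Fin d) ℂ) (f : Fin d → ℂ) (p : α) (q : β) (r : γ) :
    ((U ⊗ₖ (V ⊗ₖ W)) *ᵥ diagState f) (p, q, r) = ∑ i, f i * (U p i * (V q i * W r i)) := by
  simp [diagState, Matrix.mulVec_sum, Matrix.mulVec_smul, ket]

/-- The party whose kept factor is trivial is traced out entirely; summing over its index first
removes the phases, whatever the other two discard. -/
theorem reducedState_diagState_eq {d a₁ a₂ b₁ b₂ c₁ c₂ : ℕ}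
    {U : Matrix (Fin a₁ × Fin a₂) (Fin d) ℂ} {V : Matrix (Fin b₁ × Fin b₂) (Fin d) ℂ}
    {W : Matrix (Fin c₁ × Fin c₂) (Fin d) ℂ} (hU : IsFactorization U) (hV : IsFactorization V)
    (hW : IsFactorization W) (h1 : a₁ = 1 ∨ b₁ = 1 ∨ c₁ = 1) {f g : Fin d → ℂ}
    (hf : ∀ i, f i * star (f i) = 1) (hg : ∀ i, g i * star (g i) = 1) :
    reducedState U V W (diagState f) = reducedState U V W (diagState g) := by
  ext x y
  simp only [reducedState, Matrix.of_apply, kronecker_mulVec_diagState]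
  rcases h1 with rfl | rfl | rfl
  · have key : ∀ f : Fin d → ℂ, (∀ i, f i * star (f i) = 1) → _ := fun f hf =>
      sum_sum_mul_star f hf (fun s i => U (x.1, s) i) (fun s i => U (y.1, s) i)
        (hU.sum_mul_star x.1 y.1)
        (fun (t : Fin b₂ × Fin c₂) i => V (x.2.1, t.1) i * W (x.2.2, t.2) i)
        (fun t i => V (y.2.1, t.1) i * W (y.2.2, t.2) i)
    have h := (key f hf).trans (key g hg).symm
    rw [Finset.sum_comm, ← Fintype.sum_prod_type', Finset.sum_comm,
      ← Fintype.sum_prod_type'] at h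
    exact h
  · have key : ∀ f : Fin d → ℂ, (∀ i, f i * star (f i) = 1) → _ := fun f hf =>
      sum_sum_mul_star f hf (fun s i => V (x.2.1, s) i) (fun s i => V (y.2.1, s) i)
        (hV.sum_mul_star x.2.1 y.2.1)
        (fun (t : Fin a₂ × Fin c₂) i => U (x.1, t.1) i * W (x.2.2, t.2) i)
        (fun t i => U (y.1, t.1) i * W (y.2.2, t.2) i)
    have h := (key f hf).trans (key g hg).symm
    simp only [Fintype.sum_prod_type, mul_left_comm (V _ _)] at h ⊢
    simpa only [Finset.sum_comm (γ := Fin b₂) (α := Fin c₂)] using h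
  · have key : ∀ f : Fin d → ℂ, (∀ i, f i * star (f i) = 1) → _ := fun f hf =>
      sum_sum_mul_star f hf (fun s i => W (x.2.2, s) i) (fun s i => W (y.2.2, s) i)
        (hW.sum_mul_star x.2.2 y.2.2)
        (fun (t : Fin a₂ × Fin b₂) i => U (x.1, t.1) i * V (x.2.1, t.2) i)
        (fun t i => U (y.1, t.1) i * V (y.2.1, t.2) i)
    have h := (key f hf).trans (key g hg).symm
    simpa only [Fintype.sum_prod_type, mul_comm (W _ _), mul_assoc] using h

section Reduced

variable {a a₁ a₂ b b₁ b₂ c c₁ c₂ : ℕ} (U : Matrix (Fin a₁ × Fin a₂) (Fin a) ℂ)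
  (V : Matrix (Fin b₁ × Fin b₂) (Fin b) ℂ) (W : Matrix (Fin c₁ × Fin c₂) (Fin c) ℂ)

theorem conjTranspose_reducedState (ψ : TriState a b c) :
    (reducedState U V W ψ)ᴴ = reducedState U V W ψ := by
  ext x y
  simp [reducedState, mul_comm]

/-- The diagonal entries are sums of squared moduli of all the coordinates of (U ⊗ V ⊗ W)ψ, and U ⊗
V ⊗ W is injective. -/
theorem eq_zero_of_reducedState_eq_zero (hU : IsFactorization U) (hV : IsFactorization V)
    (hW : IsFactorization W) {ψ : TriState a b c} (h : reducedState U V W ψ = 0) : ψ = 0 := by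
  have hT : (U ⊗ₖ (V ⊗ₖ W)) *ᵥ ψ = 0 := by
    funext ⟨⟨x₁, z₁⟩, ⟨x₂, z₂⟩, ⟨x₃, z₃⟩⟩
    have h0 := congrFun (congrFun h (x₁, x₂, x₃)) (x₁, x₂, x₃)
    simp only [reducedState, Matrix.of_apply, Matrix.zero_apply, RCLike.star_def,
      Complex.mul_conj'] at h0
    norm_cast at h0
    have h1 := (Finset.sum_eq_zero_iff_of_nonneg (fun s _ => by positivity)).1 h0 (z₁, z₂, z₃)
      (Finset.mem_univ _)
    simpa using h1
  rw [← Matrix.one_mulVec ψ, ← Matrix.one_kronecker_one, ← Matrix.one_kronecker_one, ← hU.1,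
    ← hV.1, ← hW.1, Matrix.mul_kronecker_mul, Matrix.mul_kronecker_mul, ← Matrix.mulVec_mulVec,
    hT, Matrix.mulVec_zero]

end Reduced

open scoped ComplexOrder in
theorem not_hasLocalRedundancy_phi {ω : ℂ} (hω : IsPrimitiveRoot ω 3) :
    ¬ HasLocalRedundancy (phi ω) := by
  rintro ⟨a₁, a₂, b₁, b₂, c₁, c₂, U, V, W, hU, hV, hW, h1, hpw⟩
  have hn : ‖ω‖ = 1 := hω.norm'_eq_one (by norm_num)
  have e0 : phi ω 0 = diagState fun _ => 1 := by simp [phi, diagState, Fin.sum_univ_five]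
  have e1 : phi ω 1 = diagState ![1, -1, -1, -ω, -ω ^ 2] := by
    simp [phi, diagState, Fin.sum_univ_five, sub_eq_add_neg]
  have h5 : Nat.Prime 5 := by norm_num
  have heq : reducedState U V W (phi ω 0) = reducedState U V W (phi ω 1) := by
    rw [e0, e1]
    refine reducedState_diagState_eq hU hV hW ?_ (by simp) fun i => ?_
    · exact h1.imp (hU.eq_one_of_prime h5) (Or.imp (hV.eq_one_of_prime h5)
        (hW.eq_one_of_prime h5))
    · rw [RCLike.star_def, Complex.mul_conj']
      fin_cases i <;> simp [hn]
  have h0 : reducedState U V W (phi ω 0) * reducedState U V W (phi ω 1) = 0 :=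
    hpw (show (0 : Fin 3) ≠ 1 by decide)
  -- Orthogonality now says ρ² = 0 for a Hermitian ρ, that is ρᴴρ = 0, so ρ = 0.
  rw [← heq] at h0
  nth_rw 1 [← conjTranspose_reducedState] at h0
  rw [Matrix.conjTranspose_mul_self_eq_zero] at h0
  exact (isOrthogonalSet_phi hω).1 0 (eq_zero_of_reducedState_eq_zero U V W hU hV hW h0)

theorem mainTheorem4 (ω : ℂ) (hω : IsPrimitiveRoot ω 3) :
    IsOrthogonalSet (phi ω) ∧
    LocallyDistinguishable (phi ω) ∧
    ¬ HasLocalRedundancy (phi ω) ∧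
    ∃ (p : Fin 3) (n : ℕ) (M : Fin n → Matrix (Fin 5) (Fin 5) ℂ),
      IsMeasurement M ∧
      (¬ ∀ μ, ∃ t : ℂ, (M μ)ᴴ * M μ = t • (1 : Matrix (Fin 5) (Fin 5) ℂ)) ∧
      ∀ μ, IsOrthogonalSet (fun i => onParty p (M μ) (phi ω i)) ∧
        ¬ LocallyDistinguishable (fun i => onParty p (M μ) (phi ω i)) := by
  refine ⟨isOrthogonalSet_phi hω, locallyDistinguishable_phi hω, not_hasLocalRedundancy_phi hω,
    0, 2, splitting, isMeasurement_splitting, splitting_not_trivial, ?_⟩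
  rw [Fin.forall_fin_two, splitting_zero_phi, splitting_one_phi]
  exact ⟨⟨isOrthogonalSet_lowStates, not_locallyDistinguishable_lowStates⟩,
    isOrthogonalSet_highStates hω, not_locallyDistinguishable_highStates hω⟩
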